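/- **Theorem 4 (Uniform error bounds along the computed iterates).** *Setting.* Let $m\ge 2$, $p\ge1$, $T\ge 1$, $K\ge 0$ be integers. Let $\{\mathcal W_t\}_{t\ge0}$, $\mathcal W_t=(X_t^1,\dots,X_t^m)\in\mathbb R^{mp}$, be a stationary VAR(1) process $\mathcal W_{t+1}=\mathbf B^\star\mathcal W_t+\epsilon_{t+1}$ with $\det(I-z\mathbf B^\star)\ne0$ for $|z|=1$, where $\epsilon_{t+1}$ is independent of $\mathcal W_0,\dots,\mathcal W_t$ and $\epsilon_{t+1}^j\sim N(0,\sigma^2I_p)$, $\sigma>0$, for each $j$. Let $\mathcal J_0$ be a set of pairs of locations with indicator matrix $\Omega\in\{0,1\}^{p\times p}$, and suppose $\mathbf B^\star=(\Gamma^\star\otimes\Omega)\circ\mathbf\Theta^\star$ with $\Gamma^\star=(\gamma^\star_{ij})\in\mathbb R^{m\times m}$ and $\mathbf\Theta^\star=(\Theta^\star_{ij})\in\mathbb R^{mp\times mp}$, where every $p\times p$ block $\Theta^\star_{ij}$ is supported in $\mathcal J_0$, $\|\Theta^\star_{ij}\|_F=1$ if the pair $(i,j)$ is active ($\gamma^\star_{ij}\neq0$),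 and $\Theta^\star_{ij}=0$ if $\gamma^\star_{ij}=0$. Put $s_\Gamma=\|\Gamma^\star\|_0$, $s_\Theta=\max_{i,j}\|\Theta^\star_{ij}\|_0$, $\beta_\Gamma=\mathrm{vec}(\Gamma)$, $\beta_\Theta=\mathrm{vec}(\mathbf\Theta)$. Let $W\in\mathbb R^{p\times p}$ be weights with $1\le w_{ss'}\le r_w$ on $\mathcal J_0$. Let $\mathbf X,\mathbf Y\in\mathbb R^{T\times mp}$ have rows $\mathcal W_0',\dots,\mathcal W_{T-1}'$ and $\mathcal W_1',\dots,\mathcal W_T'$. *Iterates.* Let $\tau\le K$ be the number of iterations carried out ($\tau=K$, or a random stopping index bounded by $K$). Starting from $(\widehat\Gamma^{(0)},\widehat{\mathbf\Theta}^{(0)})$ with the blocks of $\widehat{\mathbf\Theta}^{(0)}$ supported in $\mathcal J_0$, let for $0\le k<\tau$ $$\widehat\Gamma^{(k+1)}\in\arg\min_{\Gamma}\ \tfrac1T\|\mathbf Y-\mathbf X((\Gamma\otimes\Omega)\circ\widehat{\mathbf\Theta}^{(k)})'\|_F^2+\lambda_T^{k+1}\|\Gamma\|_1,$$ $$\widehat{\mathbf\Theta}^{(k+1)}\in\arg\min_{\mathcal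 J(\mathbf\Theta)\subseteq\mathcal J_0}\ \tfrac1T\|\mathbf Y-\mathbf X((\widehat\Gamma^{(k+1)}\otimes\Omega)\circ\mathbf\Theta)'\|_F^2+\mu_T^{k+1}\sum_{i,j}\|W\circ\Theta_{ij}\|_1 .$$ Let $A_\Gamma^{(k)}$ be the matrix of the linear map $\mathrm{vec}(\Gamma)\mapsto\mathrm{vec}(\mathbf X\mathbf B')$, where $\mathbf B$ has blocks $\gamma_{ij}\widehat\Theta_{ij}^{(k)}$, and $A_\Theta^{(k)}$ that of $\mathrm{vec}(\mathbf\Theta)\mapsto\mathrm{vec}(\mathbf X\mathbf B')$, where $\mathbf B$ has blocks $\widehat\gamma_{ij}^{(k+1)}\Theta_{ij}$; for $A\in\{A_\Gamma^{(k)},A_\Theta^{(k)}\}$ put $G_A=A'A/T$ and $g_A=A'\mathrm{vec}(\mathbf Y)/T$. *Assumptions.* Fix positive constants $\alpha_\Gamma,\alpha_\Theta,\kappa,a_\Gamma,b_\Gamma,a_\Theta,b_\Theta,C_\Gamma^{(0)},C_\Theta^{(0)},c_1,\dots,c_4$ and $r_w\ge1$, and let $\delta=c_1e^{-c_2(\log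 m+\log p)}+c_3T^{-c_4}$. Let $\mathbb Q_\Gamma,\mathbb Q_\Theta$ be deterministic numbers and $\phi_\Gamma,\phi_\Theta\le\kappa(\log m+\log p)/T$. 1. (Local initializer) With probability at least $1-\delta$, $\|\widehat\beta_\Gamma^{(0)}-\beta_\Gamma^\star\|_\infty\le C_\Gamma^{(0)}\sqrt{\log m/T}$ and $\|\widehat\beta_\Theta^{(0)}-\beta_\Theta^\star\|_\infty\le C_\Theta^{(0)}\sqrt{(\log m+\log p)/T}$. 2. For each $k<K$, with probability at least $1-\delta$, if $k<\tau$ then the following hold. - (RE) $u'G_{A}u\ge\alpha_\Gamma\|u_{\rm act}\|_2^2-\phi_\Gamma\|u\|_1^2$ for all $u\in\mathbb R^{m^2}$ with $A=A_\Gamma^{(k)}$, and $v'G_{A}v\ge\alpha_\Theta\|v_{\rm act}\|_2^2-\phi_\Theta\|v\|_1^2$ for all $v\in\mathbb R^{m^2p^2}$ with $A=A_\Theta^{(k)}$, where the subscript act restricts a vector to the coordinates that belong to active pairs (in particular this holds if the inequalities hold with $\|u\|_2^2,\|v\|_2^2$). - (Deviation bound) $\|g_A-G_A\beta_\Gamma^\star\|_\infty\le\mathbb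 Q_\Gamma\sqrt{\log m/T}$ with $A=A_\Gamma^{(k)}$, and $\|g_A-G_A\beta_\Theta^\star\|_\infty\le\mathbb Q_\Theta\sqrt{(\log m+\log p)/T}$ with $A=A_\Theta^{(k)}$. 3. (Tuning) For $1\le k\le K$: $\max(a_\Gamma,4\mathbb Q_\Gamma)\sqrt{\log m/T}\le\lambda_T^k\le b_\Gamma\sqrt{\log m/T}$ and $\max(a_\Theta,4\mathbb Q_\Theta)\sqrt{(\log m+\log p)/T}\le\mu_T^k\le b_\Theta\sqrt{(\log m+\log p)/T}$. *Conclusion.* There are constants $c_T,C_\Gamma,C_\Theta,C_1,C_2,C_3,C_4>0$, depending only on the constants fixed above (and not on $m,p,T,K$, the true parameters, or the process), such that whenever $T\ge c_T\,s_\Gamma s_\Theta(\log m+\log p)$, with probability at least $$1-C_1Ke^{-C_2(\log m+\log p)}-C_3KT^{-C_4}$$ one has simultaneously for all $1\le k\le\tau$ $$\|\widehat\beta_\Gamma^{(k)}-\beta_\Gamma^\star\|_1\le C_\Gamma s_\Gamma\sqrt{\frac{\log m}{T}},\qquad \|\widehat\beta_\Theta^{(k)}-\beta_\Theta^\star\|_1\le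 C_\Theta s_\Theta s_\Gamma\sqrt{\frac{\log m+\log p}{T}}.$$ -/

import Mathlib

open MeasureTheory ProbabilityTheory
open scoped Matrix Kronecker NNReal

noncomputable section

namespace SpatialVAR

/-- Failure-probability form of "`E` holds with probability at least `q`". For measurable events
this is `q ≤ P E`; for other events it is the stronger statement that the outer measure of the
complement is at most `1 - q`. -/
def WithProbAtLeast {Ω : Type*} [MeasurableSpace Ω] (P : Measure Ω) (q : ℝ) (E : Ω → Prop) :
    Prop :=
  P.real {ω | ¬ E ω} ≤ 1 - q

/-- The (vectorized) `ℓ₁` norm. -/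
def l1 {ι : Type*} [Fintype ι] (u : ι → ℝ) : ℝ := ∑ q, |u q|

/-- The squared Frobenius norm. -/
def frobSq {κ ι : Type*} [Fintype κ] [Fintype ι] (A : Matrix κ ι ℝ) : ℝ := ∑ t, ∑ q, A t q ^ 2

/-- The number `‖A‖₀` of nonzero entries. -/
def nnz {κ ι : Type*} (A : Matrix κ ι ℝ) : ℕ := {q : κ × ι | A q.1 q.2 ≠ 0}.ncard

/-- Indices `(variable, location)` of the stacked `mp`-dimensional series. -/
abbrev Idx (m p : ℕ) : Type := Fin m × Fin p

/-- The `(i, j)` block of an `mp × mp` matrix; its rows and columns are locations. -/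
def block {m p : ℕ} (Θ : Matrix (Idx m p) (Idx m p) ℝ) (i j : Fin m) :
    Matrix (Fin p) (Fin p) ℝ :=
  fun a b => Θ (i, a) (j, b)

/-- The 0/1 indicator matrix of the spatial structure `J₀`. -/
def indicatorMatrix {p : ℕ} (J₀ : Finset (Fin p × Fin p)) : Matrix (Fin p) (Fin p) ℝ :=
  fun a b => if (a, b) ∈ J₀ then 1 else 0

/-- The transition matrix `(Γ ⊗ Ω) ∘ Θ`, with `Ω` the indicator matrix of `J₀`. -/
def transition {m p : ℕ} (J₀ : Finset (Fin p × Fin p)) (Γ : Matrix (Fin m) (Fin m) ℝ)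
    (Θ : Matrix (Idx m p) (Idx m p) ℝ) : Matrix (Idx m p) (Idx m p) ℝ :=
  (Γ ⊗ₖ indicatorMatrix J₀) ⊙ Θ

/-- Every block of `Θ` is supported in `J₀`. -/
def SupportedIn {m p : ℕ} (J₀ : Finset (Fin p × Fin p))
    (Θ : Matrix (Idx m p) (Idx m p) ℝ) : Prop :=
  ∀ i j a b, (a, b) ∉ J₀ → block Θ i j a b = 0

/-- The true parameters: spatial blocks supported in `J₀`, active blocks of Frobenius norm one,
inactive blocks zero. -/
structure IsNormalizedTruth {m p : ℕ} (J₀ : Finset (Fin p × Fin p))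
    (Γ : Matrix (Fin m) (Fin m) ℝ) (Θ : Matrix (Idx m p) (Idx m p) ℝ) : Prop where
  supported : SupportedIn J₀ Θ
  active : ∀ i j, Γ i j ≠ 0 → frobSq (block Θ i j) = 1
  inactive : ∀ i j, Γ i j = 0 → block Θ i j = 0

/-- The largest number of nonzero entries in one block of `Θ`. -/
def blockSparsity {m p : ℕ} (Θ : Matrix (Idx m p) (Idx m p) ℝ) : ℕ :=
  Finset.univ.sup fun ij : Fin m × Fin m => nnz (block Θ ij.1 ij.2)

/-- `X` is a stationary stable VAR(1) process with transition matrix `B` and Gaussian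
innovations `ε` (`ε_t^j ∼ N(0, σ² I_p)` for every variable `j`), independent of the past. -/
structure IsGaussianVAR {Ω : Type*} [MeasurableSpace Ω] (P : Measure Ω) {m p : ℕ}
    (B : Matrix (Idx m p) (Idx m p) ℝ) (σ : ℝ≥0) (X ε : ℕ → Ω → Idx m p → ℝ) : Prop where
  measurable_process : ∀ t, Measurable (X t)
  measurable_noise : ∀ t, Measurable (ε t)
  recursion : ∀ t ω, X (t + 1) ω = B *ᵥ X t ω + ε (t + 1) ω
  gaussian_noise : ∀ t j, P.map (fun ω (s : Fin p) => ε (t + 1) ω (j, s)) =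
    Measure.pi fun _ : Fin p => gaussianReal 0 (σ ^ 2)
  innovation : ∀ t, IndepFun (fun ω (k : Fin (t + 1)) => X k ω) (ε (t + 1)) P
  stationary : ∀ h, IdentDistrib (fun ω t => X (t + h) ω) (fun ω t => X t ω) P P
  stable : ∀ z : ℂ, ‖z‖ = 1 →
    (1 - z • B.map (fun x : ℝ => (x : ℂ)) : Matrix (Idx m p) (Idx m p) ℂ).det ≠ 0

/-- The `T × mp` matrix with rows `x_0, …, x_{T-1}` (lagged values). -/
def lagMatrix {m p : ℕ} (T : ℕ) (x : ℕ → Idx m p → ℝ) : Matrix (Fin T) (Idx m p) ℝ :=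
  fun t => x t

/-- The `T × mp` matrix with rows `x_1, …, x_T` (responses). -/
def responseMatrix {m p : ℕ} (T : ℕ) (x : ℕ → Idx m p → ℝ) : Matrix (Fin T) (Idx m p) ℝ :=
  fun t => x (t + 1)

/-- The least-squares loss `T⁻¹ ‖Y - X ((Γ ⊗ Ω) ∘ Θ)'‖_F²`. -/
def loss {m p : ℕ} (T : ℕ) (x : ℕ → Idx m p → ℝ) (J₀ : Finset (Fin p × Fin p))
    (Γ : Matrix (Fin m) (Fin m) ℝ) (Θ : Matrix (Idx m p) (Idx m p) ℝ) : ℝ :=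
  (1 / (T : ℝ)) * frobSq (responseMatrix T x - lagMatrix T x * (transition J₀ Γ Θ)ᵀ)

/-- The weighted penalty `∑_{i,j} ‖W ∘ Θ_{ij}‖₁`. -/
def weightedPenalty {m p : ℕ} (W : Matrix (Fin p) (Fin p) ℝ)
    (Θ : Matrix (Idx m p) (Idx m p) ℝ) : ℝ :=
  ∑ i, ∑ j, l1 (W ⊙ block Θ i j).vec

/-- `G` is an exact `Γ`-update from `Θ`, with tuning parameter `lam`. -/
def IsGammaUpdate {m p : ℕ} (T : ℕ) (x : ℕ → Idx m p → ℝ) (J₀ : Finset (Fin p × Fin p))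
    (lam : ℝ) (Θ : Matrix (Idx m p) (Idx m p) ℝ) (G : Matrix (Fin m) (Fin m) ℝ) : Prop :=
  IsMinOn (fun Γ => loss T x J₀ Γ Θ + lam * l1 Γ.vec) Set.univ G

/-- `H` is an exact `Θ`-update from `Γ`, with tuning parameter `mu`. -/
def IsThetaUpdate {m p : ℕ} (T : ℕ) (x : ℕ → Idx m p → ℝ) (J₀ : Finset (Fin p × Fin p))
    (W : Matrix (Fin p) (Fin p) ℝ) (mu : ℝ) (Γ : Matrix (Fin m) (Fin m) ℝ)
    (H : Matrix (Idx m p) (Idx m p) ℝ) : Prop :=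
  SupportedIn J₀ H ∧
    IsMinOn (fun Θ => loss T x J₀ Γ Θ + mu * weightedPenalty W Θ) {Θ | SupportedIn J₀ Θ} H

/-- Design matrix of the `Γ`-update, for the response `vec Y` and the coefficient `vec Γ`: the
column of `γ_{ij}` (index `(j, i)`) is `𝒳_j Θ_{ij}'` in the rows of variable `i`, else zero. -/
def gammaDesign {m p : ℕ} (T : ℕ) (x : ℕ → Idx m p → ℝ)
    (Θ : Matrix (Idx m p) (Idx m p) ℝ) :
    Matrix (Idx m p × Fin T) (Fin m × Fin m) ℝ :=
  fun r c => if r.1.1 = c.2 then ∑ b, x r.2 (c.1, b) * Θ r.1 (c.1, b) else 0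

/-- Design matrix of the `Θ`-update, for the response `vec Y` and the coefficient `vec Θ`: the
column of `Θ_{ij}(a, b)` (index `((j, b), (i, a))`) is `γ_{ij}` times the lagged series
`(j, b)` in the rows of coordinate `(i, a)`, else zero. -/
def thetaDesign {m p : ℕ} (T : ℕ) (x : ℕ → Idx m p → ℝ) (Γ : Matrix (Fin m) (Fin m) ℝ) :
    Matrix (Idx m p × Fin T) (Idx m p × Idx m p) ℝ :=
  fun r c => if r.1 = c.2 then Γ c.2.1 c.1.1 * x r.2 c.1 else 0

/-- The empirical Gram matrix `A'A / T` of a design matrix `A`. -/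
def gram {κ ι : Type*} [Fintype κ] (T : ℕ) (A : Matrix κ ι ℝ) : Matrix ι ι ℝ :=
  (1 / (T : ℝ)) • (Aᵀ * A)

/-- The vector `A'y / T`. -/
def crossMoment {κ ι : Type*} [Fintype κ] (T : ℕ) (A : Matrix κ ι ℝ) (y : κ → ℝ) : ι → ℝ :=
  (1 / (T : ℝ)) • (Aᵀ *ᵥ y)

/-- Restricted eigenvalue condition `u'Gu ≥ α ‖u_A‖₂² - φ ‖u‖₁²` for all `u`, with the curvature
term on the coordinates in `A`. The case `A = univ` is the usual condition and implies the
one for every other `A` (if `0 ≤ α`). -/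
def RestrictedEigenvalue {ι : Type*} [Fintype ι] (A : Set ι) (G : Matrix ι ι ℝ) (α φ : ℝ) :
    Prop :=
  ∀ u : ι → ℝ, α * (∑ q, A.indicator (fun q => u q ^ 2) q) - φ * l1 u ^ 2 ≤ u ⬝ᵥ (G *ᵥ u)

theorem RestrictedEigenvalue.of_univ {ι : Type*} [Fintype ι] {G : Matrix ι ι ℝ} {α φ : ℝ}
    (hα : 0 ≤ α) (h : RestrictedEigenvalue Set.univ G α φ) (A : Set ι) :
    RestrictedEigenvalue A G α φ := by
  intro u
  refine le_trans ?_ (h u)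
  have : ∑ q, A.indicator (fun q => u q ^ 2) q ≤ ∑ q, Set.univ.indicator (fun q => u q ^ 2) q :=
    Finset.sum_le_sum fun q _ =>
      Set.indicator_le_indicator_of_subset (Set.subset_univ A) (fun q => sq_nonneg (u q)) q
  have := mul_le_mul_of_nonneg_left this hα
  linarith

/-- Deviation bound `‖A'y / T - (A'A / T) β‖_∞ ≤ r`. -/
def DeviationBound {κ ι : Type*} [Fintype κ] [Fintype ι] (T : ℕ) (A : Matrix κ ι ℝ)
    (y : κ → ℝ) (β : ι → ℝ) (r : ℝ) : Prop :=
  ‖crossMoment T A y - gram T A *ᵥ β‖ ≤ r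

/-- Coordinates of `vec Γ` that belong to active pairs `(i, j)`, those with `γ_{ij} ≠ 0`. For an
inactive pair the true coefficient and the true block both vanish, so that the design columns of
the pair are close to zero near the truth and carry no curvature. -/
def gammaActive {m : ℕ} (Γ : Matrix (Fin m) (Fin m) ℝ) : Set (Fin m × Fin m) :=
  {c | Γ c.2 c.1 ≠ 0}

/-- Coordinates of `vec Θ` that belong to blocks of active pairs. -/
def thetaActive {m : ℕ} (p : ℕ) (Γ : Matrix (Fin m) (Fin m) ℝ) : Set (Idx m p × Idx m p) :=
  {c | Γ c.2.1 c.1.1 ≠ 0}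

/-- `√(log m / T)`. -/
def rateGamma (m T : ℕ) : ℝ := √(Real.log m / T)

/-- `√((log m + log p) / T)`. -/
def rateTheta (m p T : ℕ) : ℝ := √((Real.log m + Real.log p) / T)

end SpatialVAR

end

/-!
The iterates are analysed one at a time. Each update is a (weighted) Lasso regression of `vec Y` on
the design `A` built from the latest iterate, and the same true coefficient `β⋆` serves at every
step. Comparing the objective at the minimizer `b` with its value at `β⋆` gives, for `v = b - β⋆`,
`G = A'A / T` and `g = A' vec Y / T`,
`v'Gv - 2 v'(g - Gβ⋆) ≤ λ (∑ w |β⋆| - ∑ w |b|)`. The deviation bound and `4Q · rate ≤ λ` turn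
this into `v'Gv ≤ λ ((ρ + 1/2) ‖v_S‖₁ - ‖v_{Sᶜ}‖₁ / 2)` with `S` the support of `β⋆`. As `v'Gv ≥ 0`,
the error lies in the cone `‖v‖₁ ≤ (2ρ + 2) ‖v_S‖₁`, where the sample size condition lets the
curvature absorb the tolerance term of the restricted eigenvalue condition; Cauchy–Schwarz then
yields `‖v‖₁ ≤ (2ρ + 2)(2ρ + 1) |S| λ / α` (`SpatialVAR.lasso_l1_error`). Curvature is only needed on
active pairs, since `S` consists of active coordinates.

For the `Γ`-update `|S| = s_Γ` and `ρ = 1`; for the `Θ`-update `|S| ≤ s_Γ s_Θ`. Since the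
assumptions hold directly at the computed iterates, with constants that do not depend on the
iteration, the errors do not accumulate, and a union bound over the `K` iterations finishes the
proof.
-/

namespace SpatialVAR

/-! ### The deterministic Lasso bound -/

section Lasso

variable {κ ι : Type*} [Fintype κ] [Fintype ι]

lemma dotProduct_gram_mulVec (T : ℕ) (A : Matrix κ ι ℝ) (v z : ι → ℝ) :
    v ⬝ᵥ (gram T A *ᵥ z) = (1 / (T : ℝ)) * ((A *ᵥ v) ⬝ᵥ (A *ᵥ z)) := by
  rw [gram, Matrix.smul_mulVec, dotProduct_smul, ← Matrix.mulVec_mulVec,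
    Matrix.dotProduct_mulVec, Matrix.vecMul_transpose, smul_eq_mul]

lemma dotProduct_gram_mulVec_self_nonneg (T : ℕ) (A : Matrix κ ι ℝ) (v : ι → ℝ) :
    0 ≤ v ⬝ᵥ (gram T A *ᵥ v) := by
  rw [dotProduct_gram_mulVec]
  exact mul_nonneg (by positivity) (Finset.sum_nonneg fun i _ => mul_self_nonneg _)

lemma dotProduct_crossMoment (T : ℕ) (A : Matrix κ ι ℝ) (y : κ → ℝ) (v : ι → ℝ) :
    v ⬝ᵥ crossMoment T A y = (1 / (T : ℝ)) * ((A *ᵥ v) ⬝ᵥ y) := by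
  rw [crossMoment, dotProduct_smul, Matrix.dotProduct_mulVec, Matrix.vecMul_transpose,
    smul_eq_mul]

/-- Second-order expansion of the quadratic loss around `β`. -/
lemma sum_sq_residual_sub (T : ℕ) (A : Matrix κ ι ℝ) (y : κ → ℝ) (b β : ι → ℝ) :
    (1 / (T : ℝ)) * ∑ r, (y r - (A *ᵥ b) r) ^ 2 - (1 / (T : ℝ)) * ∑ r, (y r - (A *ᵥ β) r) ^ 2 =
      (b - β) ⬝ᵥ (gram T A *ᵥ (b - β)) -
        2 * ((b - β) ⬝ᵥ (crossMoment T A y - gram T A *ᵥ β)) := by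
  rw [dotProduct_sub, dotProduct_crossMoment, dotProduct_gram_mulVec, dotProduct_gram_mulVec,
    Matrix.mulVec_sub]
  simp only [dotProduct, Pi.sub_apply]
  simp only [Finset.mul_sum, ← Finset.sum_sub_distrib]
  exact Finset.sum_congr rfl fun r _ => by ring

lemma dotProduct_le_l1_mul_norm (v z : ι → ℝ) : v ⬝ᵥ z ≤ l1 v * ‖z‖ := by
  rw [l1, Finset.sum_mul]
  refine Finset.sum_le_sum fun q _ => (le_abs_self _).trans ?_
  rw [abs_mul]
  exact mul_le_mul_of_nonneg_left (norm_le_pi_norm z q) (abs_nonneg _)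

/-- Oracle inequality for the weighted Lasso, in `ℓ₁` norm: `b` is a point whose penalized loss is
not larger than that of the `S`-sparse vector `β`. The weights are only controlled where `b` and
`β` differ. -/
lemma lasso_l1_error {T : ℕ} {A : Matrix κ ι ℝ} {y : κ → ℝ} {b β w : ι → ℝ} {S : Finset ι}
    {act : Set ι} {α φ ρ lam r : ℝ} (hα : 0 < α) (hρ : 1 ≤ ρ) (hlam : 0 < lam)
    (hβ : ∀ q ∉ S, β q = 0) (hS : ∀ q ∈ S, q ∈ act)
    (hw : ∀ q, b q ≠ β q → 1 ≤ w q ∧ w q ≤ ρ)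
    (hopt : (1 / (T : ℝ)) * ∑ r, (y r - (A *ᵥ b) r) ^ 2 + lam * ∑ q, w q * |b q| ≤
      (1 / (T : ℝ)) * ∑ r, (y r - (A *ᵥ β) r) ^ 2 + lam * ∑ q, w q * |β q|)
    (hRE : RestrictedEigenvalue act (gram T A) α φ) (hDB : DeviationBound T A y β r)
    (hr : 4 * r ≤ lam) (hφ : 2 * φ * (2 * ρ + 2) ^ 2 * S.card ≤ α) :
    l1 (b - β) ≤ (2 * ρ + 2) * (2 * ρ + 1) / α * S.card * lam := by
  classical
  set v := b - β with hv
  set D := v ⬝ᵥ (gram T A *ᵥ v) with hD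
  set a := ∑ q ∈ S, |v q| with ha
  set c := ∑ q ∈ Sᶜ, |v q| with hc
  set N := ∑ q ∈ S, v q ^ 2 with hN
  have ha0 : 0 ≤ a := Finset.sum_nonneg fun _ _ => abs_nonneg _
  have hc0 : 0 ≤ c := Finset.sum_nonneg fun _ _ => abs_nonneg _
  have hN0 : 0 ≤ N := Finset.sum_nonneg fun _ _ => sq_nonneg _
  have hl1 : l1 v = a + c := (Finset.sum_add_sum_compl S _).symm
  have hD0 : 0 ≤ D := dotProduct_gram_mulVec_self_nonneg T A v
  have hdev : v ⬝ᵥ (crossMoment T A y - gram T A *ᵥ β) ≤ (a + c) * r := by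
    rw [← hl1]
    exact (dotProduct_le_l1_mul_norm _ _).trans
      (mul_le_mul_of_nonneg_left hDB (Finset.sum_nonneg fun _ _ => abs_nonneg _))
  have hpen : ∑ q, w q * |β q| - ∑ q, w q * |b q| ≤ ρ * a - c := by
    rw [← Finset.sum_sub_distrib, ← Finset.sum_add_sum_compl S, sub_eq_add_neg, ha, hc,
      Finset.mul_sum, ← Finset.sum_neg_distrib]
    refine add_le_add (Finset.sum_le_sum fun q _ => ?_) (Finset.sum_le_sum fun q hq => ?_)
    · by_cases h : b q = β q
      · simp [hv, h]
      · obtain ⟨h1, h2⟩ := hw q h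
        have h3 : |β q| - |b q| ≤ |v q| := by
          rw [hv, Pi.sub_apply, abs_sub_comm]
          exact abs_sub_abs_le_abs_sub _ _
        nlinarith [mul_le_mul_of_nonneg_left h3 (by linarith : (0 : ℝ) ≤ w q),
          mul_le_mul_of_nonneg_right h2 (abs_nonneg (v q))]
    · have hβq := hβ q (Finset.mem_compl.mp hq)
      by_cases h : b q = β q
      · simp [hv, h]
      · have := (hw q h).1
        have h4 := abs_nonneg (b q)
        simp only [hv, Pi.sub_apply, hβq, abs_zero, sub_zero, mul_zero, zero_sub]
        nlinarith
  have hbasic : D ≤ lam * ((ρ + 1 / 2) * a - c / 2) := by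
    have h1 := sum_sq_residual_sub T A y b β
    have h2 := mul_le_mul_of_nonneg_left hpen hlam.le
    have h3 := mul_le_mul_of_nonneg_left hr (add_nonneg ha0 hc0)
    linarith
  have hcone : c ≤ (2 * ρ + 1) * a := by
    have := nonneg_of_mul_nonneg_right (hD0.trans hbasic) hlam
    linarith
  have hact : N ≤ ∑ q, act.indicator (fun q => v q ^ 2) q := by
    refine le_trans (Finset.sum_le_sum fun q hq => ?_)
      (Finset.sum_le_sum_of_subset_of_nonneg (Finset.subset_univ S) fun q _ _ =>
        Set.indicator_nonneg (fun q _ => sq_nonneg (v q)) q)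
    rw [Set.indicator_of_mem (hS q hq)]
  have hCS : a ^ 2 ≤ S.card * N := by
    simpa [sq_abs] using sq_sum_le_card_mul_sum_sq (s := S) (f := fun q => |v q|)
  have hcurv : α / 2 * N ≤ D := by
    have h1 := hRE v
    have h2 := mul_le_mul_of_nonneg_left hact hα.le
    have h3 : φ * l1 v ^ 2 ≤ α / 2 * N := by
      rcases le_or_gt φ 0 with h | h
      · exact (mul_nonpos_of_nonpos_of_nonneg h (sq_nonneg _)).trans (by positivity)
      · have h4 : l1 v ^ 2 ≤ (2 * ρ + 2) ^ 2 * a ^ 2 := by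
          rw [← mul_pow, hl1]
          exact pow_le_pow_left₀ (add_nonneg ha0 hc0) (by linarith) 2
        calc φ * l1 v ^ 2 ≤ φ * ((2 * ρ + 2) ^ 2 * (S.card * N)) := by
              gcongr
              exact h4.trans (by gcongr)
          _ = 2 * φ * (2 * ρ + 2) ^ 2 * S.card / 2 * N := by ring
          _ ≤ α / 2 * N := by gcongr
    linarith
  have hafin : a ≤ (2 * ρ + 1) / α * S.card * lam := by
    rcases ha0.eq_or_lt with h | h
    · rw [← h]; positivity
    · -- cancel one factor `a` from `a² ≤ |S| N ≤ |S| (2ρ + 1) λ a / α`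
      have h1 : N ≤ (2 * ρ + 1) / α * lam * a := by
        have : α * N ≤ (2 * ρ + 1) * lam * a := by nlinarith
        rw [div_mul_eq_mul_div, div_mul_eq_mul_div, le_div_iff₀ hα]
        linarith
      have h2 : a * a ≤ ((2 * ρ + 1) / α * S.card * lam) * a := by
        calc a * a = a ^ 2 := (sq a).symm
          _ ≤ S.card * N := hCS
          _ ≤ S.card * ((2 * ρ + 1) / α * lam * a) := by gcongr
          _ = _ := by ring
      exact le_of_mul_le_mul_right h2 h
  calc l1 v = a + c := hl1
    _ ≤ (2 * ρ + 2) * a := by linarith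
    _ ≤ (2 * ρ + 2) * ((2 * ρ + 1) / α * S.card * lam) := by gcongr
    _ = _ := by ring

end Lasso

/-! ### The two updates as Lasso regressions -/

section Updates

variable {m p : ℕ} {J₀ : Finset (Fin p × Fin p)}

lemma transition_apply {Γ : Matrix (Fin m) (Fin m) ℝ} {Θ : Matrix (Idx m p) (Idx m p) ℝ}
    (hΘ : SupportedIn J₀ Θ) (r c : Idx m p) :
    transition J₀ Γ Θ r c = Γ r.1 c.1 * Θ r c := by
  simp only [transition, Matrix.hadamard_apply, Matrix.kroneckerMap_apply, indicatorMatrix]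
  split_ifs with h
  · simp
  · have : Θ r c = 0 := hΘ r.1 c.1 r.2 c.2 h
    simp [this]

lemma gammaDesign_mulVec (T : ℕ) (x : ℕ → Idx m p → ℝ) (Γ : Matrix (Fin m) (Fin m) ℝ)
    {Θ : Matrix (Idx m p) (Idx m p) ℝ} (hΘ : SupportedIn J₀ Θ) :
    gammaDesign T x Θ *ᵥ Γ.vec = (lagMatrix T x * (transition J₀ Γ Θ)ᵀ).vec := by
  ext r
  simp only [Matrix.mulVec, dotProduct, gammaDesign, Matrix.vec, Matrix.mul_apply,
    Matrix.transpose_apply, transition_apply hΘ, lagMatrix, Fintype.sum_prod_type, ite_mul,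
    zero_mul, Finset.sum_ite_eq, Finset.mem_univ, if_true, Finset.sum_mul]
  exact Finset.sum_congr rfl fun j _ => Finset.sum_congr rfl fun b _ => by ring

lemma thetaDesign_mulVec (T : ℕ) (x : ℕ → Idx m p → ℝ) (Γ : Matrix (Fin m) (Fin m) ℝ)
    {Θ : Matrix (Idx m p) (Idx m p) ℝ} (hΘ : SupportedIn J₀ Θ) :
    thetaDesign T x Γ *ᵥ Θ.vec = (lagMatrix T x * (transition J₀ Γ Θ)ᵀ).vec := by
  ext r
  simp only [Matrix.mulVec, dotProduct, thetaDesign, Matrix.vec, Matrix.mul_apply,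
    Matrix.transpose_apply, transition_apply hΘ, lagMatrix]
  rw [Fintype.sum_prod_type]
  simp only [ite_mul, zero_mul, Finset.sum_ite_eq, Finset.mem_univ, if_true]
  exact Finset.sum_congr rfl fun c _ => by ring

lemma loss_eq_sum_vec (T : ℕ) (x : ℕ → Idx m p → ℝ) (Γ : Matrix (Fin m) (Fin m) ℝ)
    (Θ : Matrix (Idx m p) (Idx m p) ℝ) :
    loss T x J₀ Γ Θ = (1 / (T : ℝ)) * ∑ r, ((responseMatrix T x).vec r -
      (lagMatrix T x * (transition J₀ Γ Θ)ᵀ).vec r) ^ 2 := by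
  rw [loss, frobSq, Fintype.sum_prod_type, Finset.sum_comm]
  rfl

lemma weightedPenalty_eq_sum_vec (W : Matrix (Fin p) (Fin p) ℝ)
    (Θ : Matrix (Idx m p) (Idx m p) ℝ) :
    weightedPenalty W Θ = ∑ c : Idx m p × Idx m p, |W c.2.2 c.1.2| * |Θ.vec c| := by
  simp only [weightedPenalty, l1, Matrix.vec, Matrix.hadamard_apply, block, abs_mul,
    Fintype.sum_prod_type]
  rw [Finset.sum_comm]
  refine Finset.sum_congr rfl fun j _ => ?_
  rw [Finset.sum_comm]

variable {Γs : Matrix (Fin m) (Fin m) ℝ} {Θs : Matrix (Idx m p) (Idx m p) ℝ}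

lemma IsNormalizedTruth.one_le_blockSparsity (h : IsNormalizedTruth J₀ Γs Θs) {i j : Fin m}
    (hij : Γs i j ≠ 0) : 1 ≤ blockSparsity Θs := by
  have h1 : 1 ≤ nnz (block Θs i j) := by
    rw [Nat.one_le_iff_ne_zero, nnz, Ne, Set.ncard_eq_zero (Set.toFinite _)]
    intro h0
    have hz : ∀ a b, block Θs i j a b = 0 := fun a b => by
      by_contra hne
      exact (Set.eq_empty_iff_forall_notMem.mp h0) (a, b) hne
    have := h.active i j hij
    simp [frobSq, hz] at this
  exact h1.trans (Finset.le_sup (f := fun ij : Fin m × Fin m => nnz (block Θs ij.1 ij.2))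
    (Finset.mem_univ (i, j)))

/-- An active pair forces a nonzero block, so that the sample size condition, stated with
`s_Γ s_Θ`, also covers the `Γ`-update. -/
lemma IsNormalizedTruth.nnz_le (h : IsNormalizedTruth J₀ Γs Θs) :
    nnz Γs ≤ nnz Γs * blockSparsity Θs := by
  rcases Nat.eq_zero_or_pos (nnz Γs) with h0 | h0
  · simp [h0]
  · obtain ⟨q, hq⟩ := Set.nonempty_of_ncard_ne_zero h0.ne'
    exact Nat.le_mul_of_pos_right _ (h.one_le_blockSparsity hq)

open Classical in
lemma card_support_vec (Γ : Matrix (Fin m) (Fin m) ℝ) :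
    (Finset.univ.filter fun c => Γ.vec c ≠ 0).card = nnz Γ := by
  rw [nnz, Set.ncard_eq_toFinset_card', ← Finset.card_map (Equiv.prodComm _ _).toEmbedding]
  congr 1
  ext ⟨i, j⟩
  rw [Finset.mem_map_equiv, Finset.mem_filter, Set.mem_toFinset]
  exact and_iff_right (Finset.mem_univ _)

open Classical in
/-- The support of `Θ⋆` splits over the active pairs, each contributing at most `s_Θ` entries. -/
lemma IsNormalizedTruth.card_support_theta_le (h : IsNormalizedTruth J₀ Γs Θs) :
    (Finset.univ.filter fun c => Θs.vec c ≠ 0).card ≤ nnz Γs * blockSparsity Θs := by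
  set S := Finset.univ.filter fun c => Θs.vec c ≠ 0
  have hmaps : ∀ c ∈ S, (c.1.1, c.2.1) ∈ Finset.univ.filter fun c => Γs.vec c ≠ 0 := by
    intro c hc
    refine Finset.mem_filter.mpr ⟨Finset.mem_univ _, fun h0 => (Finset.mem_filter.mp hc).2 ?_⟩
    exact congrFun (congrFun (h.inactive _ _ h0) c.2.2) c.1.2
  rw [Finset.card_eq_sum_card_fiberwise hmaps, ← card_support_vec Γs, ← smul_eq_mul]
  refine Finset.sum_le_card_nsmul _ _ _ fun d _ => ?_
  refine le_trans ?_ (Finset.le_sup (f := fun ij : Fin m × Fin m => nnz (block Θs ij.1 ij.2))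
    (Finset.mem_univ (d.2, d.1)))
  rw [nnz, Set.ncard_eq_toFinset_card']
  refine Finset.card_le_card_of_injOn (fun c => (c.2.2, c.1.2)) ?_ ?_
  · rintro ⟨⟨j, b⟩, ⟨i, a⟩⟩ hc
    obtain ⟨hcS, rfl⟩ := Finset.mem_filter.mp hc
    exact Finset.mem_coe.mpr (Set.mem_toFinset.mpr (Finset.mem_filter.mp hcS).2)
  · rintro ⟨⟨j, b⟩, ⟨i, a⟩⟩ hc ⟨⟨j', b'⟩, ⟨i', a'⟩⟩ hc' heq
    obtain ⟨-, rfl⟩ := Finset.mem_filter.mp hc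
    obtain ⟨-, hd⟩ := Finset.mem_filter.mp hc'
    simp only [Prod.mk.injEq] at hd heq ⊢
    exact ⟨⟨hd.1.symm, heq.2⟩, hd.2.symm, heq.1⟩

lemma l1_gammaUpdate_sub_le {T : ℕ} {x : ℕ → Idx m p → ℝ} {Θ : Matrix (Idx m p) (Idx m p) ℝ}
    {G : Matrix (Fin m) (Fin m) ℝ} {α φ lam r : ℝ} (hα : 0 < α) (hlam : 0 < lam)
    (hΘ : SupportedIn J₀ Θ) (hG : IsGammaUpdate T x J₀ lam Θ G)
    (hRE : RestrictedEigenvalue (gammaActive Γs) (gram T (gammaDesign T x Θ)) α φ)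
    (hDB : DeviationBound T (gammaDesign T x Θ) (responseMatrix T x).vec Γs.vec r)
    (hr : 4 * r ≤ lam) (hφ : 32 * φ * nnz Γs ≤ α) :
    l1 (G.vec - Γs.vec) ≤ 12 / α * nnz Γs * lam := by
  classical
  have h := lasso_l1_error (w := fun _ => 1) (ρ := 1) (b := G.vec)
    (S := Finset.univ.filter fun c => Γs.vec c ≠ 0) hα le_rfl hlam
    (fun q hq => by_contra fun h => hq (Finset.mem_filter.mpr ⟨Finset.mem_univ q, h⟩))
    (fun q hq => (Finset.mem_filter.mp hq).2)
    (fun _ _ => ⟨le_rfl, le_rfl⟩) ?_ hRE hDB hr ?_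
  · rw [card_support_vec] at h
    norm_num at h
    exact h
  · have := hG (Set.mem_univ Γs)
    simp only [Set.mem_ofPred_eq, loss_eq_sum_vec] at this
    simpa only [gammaDesign_mulVec T x _ hΘ, one_mul, l1] using this
  · rw [card_support_vec]
    linarith

lemma l1_thetaUpdate_sub_le {T : ℕ} {x : ℕ → Idx m p → ℝ} {W : Matrix (Fin p) (Fin p) ℝ}
    {Γ : Matrix (Fin m) (Fin m) ℝ} {H : Matrix (Idx m p) (Idx m p) ℝ} {α φ ρ mu r : ℝ}
    (hα : 0 < α) (hρ : 1 ≤ ρ) (hmu : 0 < mu)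
    (hW : ∀ a b, (a, b) ∈ J₀ → 1 ≤ W a b ∧ W a b ≤ ρ) (htruth : IsNormalizedTruth J₀ Γs Θs)
    (hH : IsThetaUpdate T x J₀ W mu Γ H)
    (hRE : RestrictedEigenvalue (thetaActive p Γs) (gram T (thetaDesign T x Γ)) α φ)
    (hDB : DeviationBound T (thetaDesign T x Γ) (responseMatrix T x).vec Θs.vec r)
    (hr : 4 * r ≤ mu)
    (hφ : ∀ s : ℕ, s ≤ nnz Γs * blockSparsity Θs → 2 * φ * (2 * ρ + 2) ^ 2 * s ≤ α) :
    l1 (H.vec - Θs.vec) ≤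
      (2 * ρ + 2) * (2 * ρ + 1) / α * ((nnz Γs * blockSparsity Θs : ℕ) : ℝ) * mu := by
  classical
  have hcard := htruth.card_support_theta_le
  have h := lasso_l1_error (w := fun c => |W c.2.2 c.1.2|) (b := H.vec) (act := thetaActive p Γs)
    (S := Finset.univ.filter fun c => Θs.vec c ≠ 0) hα hρ hmu
    (fun q hq => by_contra fun h => hq (Finset.mem_filter.mpr ⟨Finset.mem_univ q, h⟩))
    (fun q hq h0 => (Finset.mem_filter.mp hq).2 ?_) (fun q hq => ?_) ?_ hRE hDB hr (hφ _ hcard)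
  · refine h.trans ?_
    gcongr
  · exact congrFun (congrFun (htruth.inactive _ _ h0) q.2.2) q.1.2
  · -- outside `J₀` both `H` and `Θ⋆` vanish, so the weights there do not matter
    have hJ : (q.2.2, q.1.2) ∈ J₀ := by
      by_contra hJ
      have h1 : H.vec q = 0 := hH.1 _ _ _ _ hJ
      have h2 : Θs.vec q = 0 := htruth.supported _ _ _ _ hJ
      exact hq (h1.trans h2.symm)
    have h1 := hW _ _ hJ
    rwa [abs_of_nonneg (by linarith [h1.1])]
  · have := hH.2 htruth.supported
    simp only [Set.mem_ofPred_eq, loss_eq_sum_vec, weightedPenalty_eq_sum_vec] at this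
    simpa only [thetaDesign_mulVec T x _ hH.1, thetaDesign_mulVec T x _ htruth.supported] using this

end Updates

/-! ### Rates and the union bound -/

lemma rateGamma_pos {m T : ℕ} (hm : 2 ≤ m) (hT : 1 ≤ T) : 0 < rateGamma m T := by
  have : 0 < Real.log m := Real.log_pos (by exact_mod_cast hm)
  have : (0 : ℝ) < T := by exact_mod_cast hT
  exact Real.sqrt_pos.mpr (by positivity)

lemma rateTheta_pos {m p T : ℕ} (hm : 2 ≤ m) (hT : 1 ≤ T) : 0 < rateTheta m p T := by
  have : 0 < Real.log m := Real.log_pos (by exact_mod_cast hm)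
  have : 0 ≤ Real.log p := Real.log_natCast_nonneg p
  have : (0 : ℝ) < T := by exact_mod_cast hT
  exact Real.sqrt_pos.mpr (by positivity)

/-- The sample size condition makes the tolerance term negligible on `s ≤ N` coordinates. -/
lemma tolerance_le {α cT κ φ L R : ℝ} {s N T : ℕ} (hα : 0 < α) (hκ : 0 < κ) (hR : 0 ≤ R)
    (hL : 0 ≤ L) (hT : 1 ≤ T) (hcT : 2 * κ * R / α ≤ cT) (hTN : cT * (N * L) ≤ T)
    (hφ : φ ≤ κ * (L / T)) (hs : s ≤ N) : 2 * φ * R * s ≤ α := by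
  have hT0 : (0 : ℝ) < T := by exact_mod_cast hT
  have hsN : (s : ℝ) ≤ N := by exact_mod_cast hs
  have h1 : 2 * κ * R * (s * L) ≤ α * T := by
    have : 2 * κ * R / α * (s * L) ≤ T := by
      refine le_trans ?_ hTN
      exact mul_le_mul hcT (by gcongr) (by positivity) (le_trans (by positivity) hcT)
    rw [div_mul_eq_mul_div, div_le_iff₀ hα] at this
    linarith
  calc 2 * φ * R * s ≤ 2 * (κ * (L / T)) * R * s := by gcongr
    _ = 2 * κ * R * (s * L) / T := by ring
    _ ≤ α := by rwa [div_le_iff₀ hT0]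

/-- Union bound for events indexed by the iterations. -/
lemma WithProbAtLeast.forall_lt {Ω : Type*} [MeasurableSpace Ω] {P : Measure Ω}
    [IsProbabilityMeasure P] {K : ℕ} {d : ℝ} {E : ℕ → Ω → Prop}
    (h : ∀ k < K, WithProbAtLeast P (1 - d) (E k)) :
    WithProbAtLeast P (1 - K * d) fun ω => ∀ k < K, E k ω := by
  have hset : {ω | ¬ ∀ k < K, E k ω} = ⋃ k ∈ Finset.range K, {ω | ¬ E k ω} := by
    ext ω
    simp
  rw [WithProbAtLeast, hset]
  calc P.real (⋃ k ∈ Finset.range K, {ω | ¬ E k ω})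
      ≤ ∑ k ∈ Finset.range K, P.real {ω | ¬ E k ω} := measureReal_biUnion_finset_le _ _
    _ ≤ ∑ _k ∈ Finset.range K, d := Finset.sum_le_sum fun k hk => by
        have := h k (Finset.mem_range.mp hk)
        rw [WithProbAtLeast] at this
        linarith
    _ = 1 - (1 - K * d) := by simp

lemma WithProbAtLeast.mono {Ω : Type*} [MeasurableSpace Ω] {P : Measure Ω}
    [IsProbabilityMeasure P] {q q' : ℝ} {E F : Ω → Prop} (h : WithProbAtLeast P q E)
    (hq : q' ≤ q) (hEF : ∀ ω, E ω → F ω) : WithProbAtLeast P q' F := by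
  have h1 : P.real {ω | ¬ F ω} ≤ P.real {ω | ¬ E ω} :=
    measureReal_mono fun ω hω hE => hω (hEF ω hE)
  rw [WithProbAtLeast] at h ⊢
  linarith

end SpatialVAR

theorem theorem4
    -- curvature constants, tolerance constant, bound on the spatial weights
    (αΓ αΘ κ ρ : ℝ) (hαΓ : 0 < αΓ) (hαΘ : 0 < αΘ) (hκ : 0 < κ) (hρ : 1 ≤ ρ)
    -- constants in the orders of magnitude of the tuning parameters
    (aΓ bΓ aΘ bΘ : ℝ) (haΓ : 0 < aΓ) (hbΓ : 0 < bΓ) (haΘ : 0 < aΘ) (hbΘ : 0 < bΘ)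
    -- constants of the initializer and of the probabilities in the hypotheses
    (C0Γ C0Θ c₁ c₂ c₃ c₄ : ℝ) (hC0Γ : 0 < C0Γ) (hC0Θ : 0 < C0Θ)
    (hc₁ : 0 < c₁) (hc₂ : 0 < c₂) (hc₃ : 0 < c₃) (hc₄ : 0 < c₄) :
    ∃ cT CΓ CΘ C₁ C₂ C₃ C₄ : ℝ,
      0 < cT ∧ 0 < CΓ ∧ 0 < CΘ ∧ 0 < C₁ ∧ 0 < C₂ ∧ 0 < C₃ ∧ 0 < C₄ ∧
      ∀ (m p T K : ℕ), 2 ≤ m → 1 ≤ p → 1 ≤ T →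
      -- spatial structure, weights and true parameters
      ∀ (J₀ : Finset (Fin p × Fin p)) (W : Matrix (Fin p) (Fin p) ℝ)
        (Γs : Matrix (Fin m) (Fin m) ℝ)
        (Θs : Matrix (SpatialVAR.Idx m p) (SpatialVAR.Idx m p) ℝ),
      (∀ a b, (a, b) ∈ J₀ → 1 ≤ W a b ∧ W a b ≤ ρ) →
      SpatialVAR.IsNormalizedTruth J₀ Γs Θs →
      -- sample size
      cT * ((SpatialVAR.nnz Γs : ℝ) * SpatialVAR.blockSparsity Θs *
        (Real.log m + Real.log p)) ≤ T →
      -- the process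
      ∀ {Ω : Type*} [MeasurableSpace Ω] (P : Measure Ω) [IsProbabilityMeasure P]
        (σ : ℝ≥0) (X ε : ℕ → Ω → SpatialVAR.Idx m p → ℝ),
      0 < σ →
      SpatialVAR.IsGaussianVAR P (SpatialVAR.transition J₀ Γs Θs) σ X ε →
      -- tuning parameters, with the levels `QΓ`, `QΘ` of the deviation bounds
      ∀ (QΓ QΘ : ℝ) (lam mu : ℕ → ℝ),
      (∀ k, 1 ≤ k → k ≤ K →
        aΓ * SpatialVAR.rateGamma m T ≤ lam k ∧ lam k ≤ bΓ * SpatialVAR.rateGamma m T ∧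
        4 * QΓ * SpatialVAR.rateGamma m T ≤ lam k) →
      (∀ k, 1 ≤ k → k ≤ K →
        aΘ * SpatialVAR.rateTheta m p T ≤ mu k ∧ mu k ≤ bΘ * SpatialVAR.rateTheta m p T ∧
        4 * QΘ * SpatialVAR.rateTheta m p T ≤ mu k) →
      -- the iterates, computed up to a possibly random index `τ ≤ K`
      ∀ (τ : Ω → ℕ) (G : ℕ → Ω → Matrix (Fin m) (Fin m) ℝ)
        (H : ℕ → Ω → Matrix (SpatialVAR.Idx m p) (SpatialVAR.Idx m p) ℝ),
      (∀ ω, τ ω ≤ K) →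
      (∀ ω, SpatialVAR.SupportedIn J₀ (H 0 ω)) →
      (∀ ω k, k < τ ω →
        SpatialVAR.IsGammaUpdate T (fun t => X t ω) J₀ (lam (k + 1)) (H k ω) (G (k + 1) ω) ∧
        SpatialVAR.IsThetaUpdate T (fun t => X t ω) J₀ W (mu (k + 1)) (G (k + 1) ω)
          (H (k + 1) ω)) →
      -- local initializer
      SpatialVAR.WithProbAtLeast P
        (1 - c₁ * Real.exp (-(c₂ * (Real.log m + Real.log p))) - c₃ * (T : ℝ) ^ (-c₄))
        (fun ω => ‖(G 0 ω).vec - Γs.vec‖ ≤ C0Γ * SpatialVAR.rateGamma m T ∧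
          ‖(H 0 ω).vec - Θs.vec‖ ≤ C0Θ * SpatialVAR.rateTheta m p T) →
      -- restricted eigenvalue conditions and deviation bounds at the iterates
      ∀ φΓ φΘ : ℝ,
      φΓ ≤ κ * ((Real.log m + Real.log p) / T) →
      φΘ ≤ κ * ((Real.log m + Real.log p) / T) →
      (∀ k < K, SpatialVAR.WithProbAtLeast P
        (1 - c₁ * Real.exp (-(c₂ * (Real.log m + Real.log p))) - c₃ * (T : ℝ) ^ (-c₄))
        (fun ω => k < τ ω →
          SpatialVAR.RestrictedEigenvalue (SpatialVAR.gammaActive Γs)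
            (SpatialVAR.gram T (SpatialVAR.gammaDesign T (fun t => X t ω) (H k ω))) αΓ φΓ ∧
          SpatialVAR.DeviationBound T (SpatialVAR.gammaDesign T (fun t => X t ω) (H k ω))
            (SpatialVAR.responseMatrix T (fun t => X t ω)).vec Γs.vec
            (QΓ * SpatialVAR.rateGamma m T) ∧
          SpatialVAR.RestrictedEigenvalue (SpatialVAR.thetaActive p Γs)
            (SpatialVAR.gram T (SpatialVAR.thetaDesign T (fun t => X t ω) (G (k + 1) ω)))
            αΘ φΘ ∧
          SpatialVAR.DeviationBound T
            (SpatialVAR.thetaDesign T (fun t => X t ω) (G (k + 1) ω))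
            (SpatialVAR.responseMatrix T (fun t => X t ω)).vec Θs.vec
            (QΘ * SpatialVAR.rateTheta m p T))) →
      SpatialVAR.WithProbAtLeast P
        (1 - C₁ * K * Real.exp (-(C₂ * (Real.log m + Real.log p))) -
          C₃ * K * (T : ℝ) ^ (-C₄))
        (fun ω => ∀ k, 1 ≤ k → k ≤ τ ω →
          SpatialVAR.l1 ((G k ω).vec - Γs.vec) ≤
            CΓ * SpatialVAR.nnz Γs * SpatialVAR.rateGamma m T ∧
          SpatialVAR.l1 ((H k ω).vec - Θs.vec) ≤
            CΘ * SpatialVAR.blockSparsity Θs * SpatialVAR.nnz Γs *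
              SpatialVAR.rateTheta m p T) := by
  have hR : 16 ≤ (2 * ρ + 2) ^ 2 := by nlinarith
  refine ⟨2 * κ * (2 * ρ + 2) ^ 2 / αΓ + 2 * κ * (2 * ρ + 2) ^ 2 / αΘ, 12 * bΓ / αΓ,
    (2 * ρ + 2) * (2 * ρ + 1) * bΘ / αΘ, c₁, c₂, c₃, c₄, by positivity, by positivity,
    by positivity, hc₁, hc₂, hc₃, hc₄, ?_⟩
  intro m p T K hm hp hT J₀ W Γs Θs hW htruth hsample Ω _ P _ σ X ε hσ hVAR QΓ QΘ lam mu hlam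
    hmu τ G H hτ hH0 hupd hinit φΓ φΘ hφΓ hφΘ hgood
  have hL : 0 ≤ Real.log m + Real.log p :=
    add_nonneg (Real.log_natCast_nonneg m) (Real.log_natCast_nonneg p)
  have hsample' : (2 * κ * (2 * ρ + 2) ^ 2 / αΓ + 2 * κ * (2 * ρ + 2) ^ 2 / αΘ) *
      (((SpatialVAR.nnz Γs * SpatialVAR.blockSparsity Θs : ℕ) : ℝ) *
        (Real.log m + Real.log p)) ≤ T := by
    push_cast
    exact hsample
  have htolΓ : 32 * φΓ * SpatialVAR.nnz Γs ≤ αΓ := by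
    -- the cone constant of the unweighted penalty is `4 ≤ 2ρ + 2`
    have := SpatialVAR.tolerance_le (R := 16) hαΓ hκ (by norm_num) hL hT
      (le_trans (by gcongr) (le_add_of_nonneg_right (by positivity))) hsample' hφΓ htruth.nnz_le
    linarith
  have htolΘ : ∀ s : ℕ, s ≤ SpatialVAR.nnz Γs * SpatialVAR.blockSparsity Θs →
      2 * φΘ * (2 * ρ + 2) ^ 2 * s ≤ αΘ := fun s hs =>
    SpatialVAR.tolerance_le hαΘ hκ (by positivity) hL hT
      (le_add_of_nonneg_left (by positivity)) hsample' hφΘ hs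
  have hsupp : ∀ ω k, k ≤ τ ω → SpatialVAR.SupportedIn J₀ (H k ω) := by
    rintro ω (_ | k) hk
    · exact hH0 ω
    · exact (hupd ω k hk).2.1
  refine (SpatialVAR.WithProbAtLeast.forall_lt
    (d := c₁ * Real.exp (-(c₂ * (Real.log m + Real.log p))) + c₃ * (T : ℝ) ^ (-c₄))
    (fun k hk => (hgood k hk).mono (by linarith) fun _ h => h)).mono (by linarith) ?_
  intro ω hω k hk1 hkτ
  obtain ⟨k, rfl⟩ := Nat.exists_eq_add_of_le' hk1
  have hkK : k + 1 ≤ K := hkτ.trans (hτ ω)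
  obtain ⟨hREΓ, hDBΓ, hREΘ, hDBΘ⟩ := hω k hkK hkτ
  obtain ⟨hG, hH⟩ := hupd ω k hkτ
  obtain ⟨hla, hlb, hlQ⟩ := hlam (k + 1) hk1 hkK
  obtain ⟨hma, hmb, hmQ⟩ := hmu (k + 1) hk1 hkK
  have hl0 : 0 < lam (k + 1) := (mul_pos haΓ (SpatialVAR.rateGamma_pos hm hT)).trans_le hla
  have hm0 : 0 < mu (k + 1) := (mul_pos haΘ (SpatialVAR.rateTheta_pos hm hT)).trans_le hma
  constructor
  · refine (SpatialVAR.l1_gammaUpdate_sub_le hαΓ hl0 (hsupp ω k (Nat.le_of_succ_le hkτ)) hG hREΓ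
      hDBΓ (by linarith) htolΓ).trans ?_
    calc 12 / αΓ * SpatialVAR.nnz Γs * lam (k + 1)
        ≤ 12 / αΓ * SpatialVAR.nnz Γs * (bΓ * SpatialVAR.rateGamma m T) := by gcongr
      _ = _ := by ring
  · refine (SpatialVAR.l1_thetaUpdate_sub_le hαΘ hρ hm0 hW htruth hH hREΘ hDBΘ (by linarith)
      htolΘ).trans ?_
    calc (2 * ρ + 2) * (2 * ρ + 1) / αΘ *
          ((SpatialVAR.nnz Γs * SpatialVAR.blockSparsity Θs : ℕ) : ℝ) * mu (k + 1)
        ≤ (2 * ρ + 2) * (2 * ρ + 1) / αΘ *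
          ((SpatialVAR.nnz Γs * SpatialVAR.blockSparsity Θs : ℕ) : ℝ) *
            (bΘ * SpatialVAR.rateTheta m p T) := by gcongr
      _ = _ := by push_cast; ring
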